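/- A DFA here has a finite set of states and a transition function that may be partial; its transitions are the pairs (state, letter) at which the transition function is defined. For every integer $m\ge 4$ there is an $m$-state DFA $A$ over a three-letter alphabet $\Sigma=\{a,b,c\}$ such that the language $\mathcal L(A)$ is finite and every DFA over $\Sigma$ that accepts $\mathcal L(A)^\star$ has at least $2^{m-2}+2^{m-3}-1$ states, and at least $9\cdot 2^{m-3}-2^{\lfloor m/2\rfloor}-2$ transitions if $m$ is odd, respectively at least $9\cdot 2^{m-3}-2^{(m-2)/2}-2$ transitions if $m$ is even. -/

import Mathlib

/-- A deterministic finite automaton with a partial transition function, over the alphabet `α`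
and with state type `σ` (finiteness of `σ` is imposed where automata are used);
`step q x = none` means that no transition labelled `x` leaves `q`. -/
structure PartialDFA (α σ : Type*) where
  step : σ → α → Option σ
  start : σ
  accept : Set σ

namespace PartialDFA

variable {α σ : Type*} (M : PartialDFA α σ)

/-- The partial transition function extended to words. -/
def evalFrom (q : σ) : List α → Option σ
  | [] => some q
  | x :: w => (M.step q x).bind fun q' => evalFrom q' w

/-- The language accepted by `M`: the words whose run from the initial state is defined and
ends in a final state. -/
def accepts : Language α :=
  {w | ∃ q ∈ M.accept, M.evalFrom M.start w = some q}

/-- The number of transitions of `M`, i.e. of pairs (state, letter) at which the transition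
function is defined. -/
noncomputable def numTransitions : ℕ :=
  Set.ncard {p : σ × α | (M.step p.1 p.2).isSome}

end PartialDFA

/-! Live words with pairwise distinct residuals force distinct states, and each live one-letter
extension forces a transition. For the star of `shiftDFA n`, with `m = n + 3`, a residual is fixed
by the visited states among `1, …, n + 1` and by membership in the star: `n + 2` has no outgoing
transition, so it matters only for membership. Every class except the dead one is reached
(`exists_represents`), and distinct classes have distinct residuals
(`Represents.eq_of_residual_eq`), which gives `3 * 2 ^ n - 1` states. Only one (class, letter) pair
may lack a live extension (`Represents.live_concat`), so there are at least `9 * 2 ^ n - 4`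
transitions, more than required. -/

namespace PartialDFA

/-! ### Lower bounds from residuals -/

section General

variable {α σ : Type*} (M : PartialDFA α σ)

theorem evalFrom_append (q : σ) (u v : List α) :
    M.evalFrom q (u ++ v) = (M.evalFrom q u).bind fun q' => M.evalFrom q' v := by
  induction u generalizing q with
  | nil => simp [evalFrom]
  | cons x u ih =>
    simp only [List.cons_append, evalFrom]
    cases M.step q x <;> simp [ih]

theorem evalFrom_concat (q : σ) (u : List α) (x : α) :
    M.evalFrom q (u ++ [x]) = (M.evalFrom q u).bind fun q' => M.step q' x := by
  rw [evalFrom_append]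
  congr 1
  funext q'
  simp [evalFrom]

theorem mem_accepts_iff (w : List α) :
    w ∈ M.accepts ↔ ∃ q ∈ M.accept, M.evalFrom M.start w = some q := Iff.rfl

/-- A word is live for a language if it is a prefix of a word of the language. -/
def Live (K : Language α) (w : List α) : Prop := ∃ v, w ++ v ∈ K

theorem exists_evalFrom_of_live {w : List α} (hw : Live M.accepts w) :
    ∃ q, M.evalFrom M.start w = some q := by
  obtain ⟨v, q, -, hv⟩ := hw
  rw [evalFrom_append] at hv
  cases h : M.evalFrom M.start w with
  | none => simp [h] at hv
  | some q' => exact ⟨q', rfl⟩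

theorem residual_eq_of_evalFrom_eq {w w' : List α}
    (h : M.evalFrom M.start w = M.evalFrom M.start w') (v : List α) :
    w ++ v ∈ M.accepts ↔ w' ++ v ∈ M.accepts := by
  simp only [mem_accepts_iff, evalFrom_append, h]

variable {M} {ι : Type*} {W : ι → List α}

theorem exists_injective_states (hlive : ∀ i, Live M.accepts (W i))
    (hinj : ∀ i j, (∀ v, W i ++ v ∈ M.accepts ↔ W j ++ v ∈ M.accepts) → i = j) :
    ∃ f : ι → σ, Function.Injective f ∧ ∀ i, M.evalFrom M.start (W i) = some (f i) := by
  choose f hf using fun i => M.exists_evalFrom_of_live (hlive i)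
  refine ⟨f, fun i j hij => hinj i j (M.residual_eq_of_evalFrom_eq ?_), hf⟩
  rw [hf, hf, hij]

/-- The number of states is at least the number of live words with distinct residuals. -/
theorem card_le_card_states [Finite σ] (hlive : ∀ i, Live M.accepts (W i))
    (hinj : ∀ i j, (∀ v, W i ++ v ∈ M.accepts ↔ W j ++ v ∈ M.accepts) → i = j) :
    Nat.card ι ≤ Nat.card σ := by
  obtain ⟨f, hf, -⟩ := exists_injective_states hlive hinj
  exact Nat.card_le_card_of_injective f hf

/-- The number of transitions is at least the number of live one-letter extensions of words
with distinct residuals. -/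
theorem card_le_numTransitions [Finite σ] [Finite α] (hlive : ∀ i, Live M.accepts (W i))
    (hinj : ∀ i j, (∀ v, W i ++ v ∈ M.accepts ↔ W j ++ v ∈ M.accepts) → i = j)
    (J : Set (ι × α)) (hJ : ∀ p ∈ J, Live M.accepts (W p.1 ++ [p.2])) :
    J.ncard ≤ M.numTransitions := by
  obtain ⟨f, hf, hfW⟩ := exists_injective_states hlive hinj
  refine Set.ncard_le_ncard_of_injOn (fun p => (f p.1, p.2)) ?_ ?_ (Set.toFinite _)
  · rintro ⟨i, x⟩ hp
    obtain ⟨q, hq⟩ := M.exists_evalFrom_of_live (hJ _ hp)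
    rw [evalFrom_concat, hfW] at hq
    simp only [Option.bind_some] at hq
    simp [hq]
  · rintro ⟨i, x⟩ - ⟨j, y⟩ - h
    simp only [Prod.mk.injEq] at h
    exact Prod.ext (hf h.1) h.2

end General

/-! ### The witness automaton and its star -/

/-- The automaton with states `0, …, n + 2` and final states `n + 1`, `n + 2`, in which every
letter increments the state, except that the letter `1` sends `0` to `n + 2` and that the
letter `2` is undefined at `n`. -/
def shiftDFA (n : ℕ) : PartialDFA (Fin 3) (Fin (n + 3)) where
  step q x :=
    if x = 1 ∧ q.val = 0 then some (Fin.last (n + 2))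
    else if x = 2 ∧ q.val = n then none
    else if h : q.val + 1 < n + 3 then some ⟨q.val + 1, h⟩
    else none
  start := 0
  accept := {q | n + 1 ≤ q.val}

/-- The star of the language of `shiftDFA n`. -/
def shiftStar (n : ℕ) : Language (Fin 3) := KStar.kstar (shiftDFA n).accepts

theorem shiftDFA_step_iff {n : ℕ} (p q : Fin (n + 3)) (x : Fin 3) :
    (shiftDFA n).step p x = some q ↔
      (x = 1 ∧ p.val = 0 ∧ q.val = n + 2) ∨
      (¬ (x = 1 ∧ p.val = 0) ∧ ¬ (x = 2 ∧ p.val = n) ∧ q.val = p.val + 1) := by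
  have := q.isLt
  simp only [shiftDFA]
  split_ifs with h1 h2 h3 <;> simp only [Option.some.injEq, Fin.ext_iff, Fin.val_last] <;>
    simp <;> first | omega | grind

theorem shiftDFA_val_add_length_le {n : ℕ} (w : List (Fin 3)) (p q : Fin (n + 3))
    (h : (shiftDFA n).evalFrom p w = some q) : p.val + w.length ≤ q.val := by
  induction w generalizing p with
  | nil => simp only [evalFrom, Option.some.injEq] at h; simp [h]
  | cons x w ih =>
    simp only [evalFrom, Option.bind_eq_some_iff] at h
    obtain ⟨r, hr, hw⟩ := h
    have := ih r hw
    rw [shiftDFA_step_iff] at hr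
    simp only [List.length_cons]
    omega

theorem finite_accepts_shiftDFA (n : ℕ) :
    ((shiftDFA n).accepts : Set (List (Fin 3))).Finite := by
  refine (List.finite_length_le (Fin 3) (n + 2)).subset ?_
  rintro w ⟨q, -, hq⟩
  have := shiftDFA_val_add_length_le w _ q hq
  have := q.isLt
  simp only [Set.mem_ofPred_eq]
  omega

/-- `Visits n w i` means that, after reading a prefix of `w` in the star, `shiftDFA n` reaches
the state `i` on the remaining suffix of `w`. -/
def Visits (n : ℕ) (w : List (Fin 3)) (i : ℕ) : Prop :=
  ∃ u v, w = u ++ v ∧ u ∈ shiftStar n ∧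
    ∃ q : Fin (n + 3), (shiftDFA n).evalFrom (shiftDFA n).start v = some q ∧ q.val = i

/-! ### Effect of one letter on the visited states -/

variable {n : ℕ}

theorem nil_mem_shiftStar : [] ∈ shiftStar n := Language.nil_mem_kstar _

theorem visits_concat_iff (w : List (Fin 3)) (x : Fin 3) (i : ℕ) :
    Visits n (w ++ [x]) i ↔ (i = 0 ∧ w ++ [x] ∈ shiftStar n) ∨
      ∃ p q : Fin (n + 3), Visits n w p ∧ (shiftDFA n).step p x = some q ∧ q.val = i := by
  constructor
  · rintro ⟨u, v, hw, hu, q, hq, rfl⟩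
    rcases List.eq_nil_or_concat v with rfl | ⟨v, y, rfl⟩
    · left
      simp only [evalFrom, Option.some.injEq] at hq
      subst hq
      rw [hw, List.append_nil]
      exact ⟨rfl, hu⟩
    · right
      rw [List.concat_eq_append] at hw hq
      rw [← List.append_assoc] at hw
      obtain ⟨rfl, hxy⟩ := List.append_inj' hw rfl
      obtain rfl : x = y := by simpa using hxy
      rw [evalFrom_concat, Option.bind_eq_some_iff] at hq
      obtain ⟨p, hp, hpq⟩ := hq
      exact ⟨p, q, ⟨u, v, rfl, hu, p, hp, rfl⟩, hpq, rfl⟩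
  · rintro (⟨rfl, h⟩ | ⟨p, q, ⟨u, v, rfl, hu, p', hp', hpp⟩, hpq, rfl⟩)
    · exact ⟨w ++ [x], [], by simp, h, 0, rfl, rfl⟩
    · obtain rfl := Fin.ext hpp
      refine ⟨u, v ++ [x], by simp, hu, q, ?_, rfl⟩
      rw [evalFrom_concat, hp']
      exact hpq

theorem visits_le {w : List (Fin 3)} {i : ℕ} (h : Visits n w i) : i ≤ n + 2 := by
  obtain ⟨u, v, -, -, q, -, rfl⟩ := h
  have := q.isLt
  omega

theorem visits_nil_iff (i : ℕ) : Visits n [] i ↔ i = 0 := by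
  constructor
  · rintro ⟨u, v, h, -, q, hq, rfl⟩
    obtain ⟨rfl, rfl⟩ := List.append_eq_nil_iff.1 h.symm
    simp only [evalFrom, Option.some.injEq] at hq
    subst hq
    rfl
  · rintro rfl
    exact ⟨[], [], rfl, nil_mem_shiftStar, 0, rfl, rfl⟩

theorem visits_zero_iff (w : List (Fin 3)) : Visits n w 0 ↔ w ∈ shiftStar n := by
  rcases List.eq_nil_or_concat w with rfl | ⟨w, x, rfl⟩
  · simp [visits_nil_iff, nil_mem_shiftStar]
  · rw [List.concat_eq_append, visits_concat_iff]
    refine ⟨?_, fun h => Or.inl ⟨rfl, h⟩⟩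
    rintro (h | ⟨p, q, -, h, hq⟩)
    · exact h.2
    · rw [shiftDFA_step_iff] at h
      omega

theorem mem_shiftStar_iff (w : List (Fin 3)) :
    w ∈ shiftStar n ↔ w = [] ∨ Visits n w (n + 1) ∨ Visits n w (n + 2) := by
  constructor
  · intro h
    rw [shiftStar, ← Language.one_add_kstar_mul_self_eq_kstar] at h
    rcases h with h | ⟨u, hu, v, ⟨q, hq, hv⟩, rfl⟩
    · exact Or.inl h
    · right
      have h1 : n + 1 ≤ q.val := hq
      have h2 := q.isLt
      have : Visits n (u ++ v) q := ⟨u, v, rfl, hu, q, hv, rfl⟩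
      rcases (by omega : q.val = n + 1 ∨ q.val = n + 2) with h | h <;> rw [h] at this
      · exact Or.inl this
      · exact Or.inr this
  · have key : ∀ i, n + 1 ≤ i → Visits n w i → w ∈ shiftStar n := by
      rintro i hi ⟨u, v, rfl, hu, q, hq, rfl⟩
      rw [shiftStar, ← Language.one_add_kstar_mul_self_eq_kstar]
      exact Or.inr ⟨u, hu, v, ⟨q, hi, hq⟩, rfl⟩
    rintro (rfl | h | h)
    · exact nil_mem_shiftStar
    · exact key _ le_rfl h
    · exact key _ (by omega) h

theorem visits_concat_one_iff (hn : 1 ≤ n) (w : List (Fin 3)) (x : Fin 3) :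
    Visits n (w ++ [x]) 1 ↔ x ≠ 1 ∧ w ∈ shiftStar n := by
  rw [visits_concat_iff]
  constructor
  · rintro (h | ⟨p, q, hp, h, hq⟩)
    · omega
    · rw [shiftDFA_step_iff] at h
      have h0 : p.val = 0 := by omega
      rw [h0] at hp
      exact ⟨fun hx => by omega, (visits_zero_iff w).1 hp⟩
  · rintro ⟨hx, h⟩
    refine Or.inr ⟨0, ⟨1, by omega⟩, (visits_zero_iff w).2 h, ?_, rfl⟩
    rw [shiftDFA_step_iff]
    refine Or.inr ⟨by tauto, fun h => ?_, by simp⟩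
    have := h.2
    simp at this
    omega

theorem visits_concat_succ_iff {i : ℕ} (hi : 1 ≤ i) (hin : i ≤ n) (w : List (Fin 3))
    (x : Fin 3) : Visits n (w ++ [x]) (i + 1) ↔ ¬ (x = 2 ∧ i = n) ∧ Visits n w i := by
  rw [visits_concat_iff]
  constructor
  · rintro (h | ⟨p, q, hp, h, hq⟩)
    · omega
    · rw [shiftDFA_step_iff] at h
      have h0 : p.val = i := by omega
      rw [h0] at hp
      refine ⟨?_, hp⟩
      omega
  · rintro ⟨hx, h⟩
    refine Or.inr ⟨⟨i, by omega⟩, ⟨i + 1, by omega⟩, h, ?_, rfl⟩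
    rw [shiftDFA_step_iff]
    refine Or.inr ⟨?_, hx, rfl⟩
    rintro ⟨-, h⟩
    simp at h
    omega

theorem visits_concat_last_iff (w : List (Fin 3)) (x : Fin 3) :
    Visits n (w ++ [x]) (n + 2) ↔ Visits n w (n + 1) ∨ (x = 1 ∧ w ∈ shiftStar n) := by
  rw [visits_concat_iff]
  constructor
  · rintro (h | ⟨p, q, hp, h, hq⟩)
    · omega
    · rw [shiftDFA_step_iff] at h
      rcases h with ⟨h1, h2, -⟩ | ⟨-, -, h⟩
      · rw [h2] at hp
        exact Or.inr ⟨h1, (visits_zero_iff w).1 hp⟩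
      · have h0 : p.val = n + 1 := by omega
        rw [h0] at hp
        exact Or.inl hp
  · rintro (h | ⟨hx, h⟩)
    · refine Or.inr ⟨⟨n + 1, by omega⟩, Fin.last _, h, ?_, rfl⟩
      rw [shiftDFA_step_iff]
      refine Or.inr ⟨?_, ?_, rfl⟩
      · rintro ⟨-, h⟩
        simp at h
      · rintro ⟨-, h⟩
        simp at h
    · refine Or.inr ⟨0, Fin.last _, (visits_zero_iff w).2 h, ?_, rfl⟩
      rw [shiftDFA_step_iff]
      exact Or.inl ⟨hx, rfl, rfl⟩

/-! ### Reachability of prescribed sets of states -/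

theorem visits_append_replicate_iff {i : ℕ} (hi : 1 ≤ i) (w : List (Fin 3)) (j : ℕ)
    (hij : i + j ≤ n + 1) : Visits n (w ++ List.replicate j 0) (i + j) ↔ Visits n w i := by
  induction j with
  | zero => simp
  | succ j ih =>
    rw [List.replicate_succ', ← List.append_assoc, ← Nat.add_assoc,
      visits_concat_succ_iff (by omega) (by omega), ih (by omega)]
    simp

/-- A word with the states `n + 2 - k, …, n + 1` visited can be continued by `t ≤ k` letters
so that the visited states among `1, …, t` are prescribed. -/
theorem exists_visits_prefix (hn : 1 ≤ n) (w : List (Fin 3)) {k : ℕ} (hk : k ≤ n + 1)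
    (hw : ∀ i, n + 2 - k ≤ i → i ≤ n + 1 → Visits n w i) (g : ℕ → Prop) (t : ℕ) (ht : t ≤ k) :
    ∃ w', (∀ i, 1 ≤ i → i ≤ t → (Visits n w' i ↔ g (t - i))) ∧
      ∀ i, n + 2 - k + t ≤ i → i ≤ n + 1 + t → i ≤ n + 2 → Visits n w' i := by
  classical
  induction t with
  | zero => exact ⟨w, by omega, fun i h1 h2 _ => hw i (by omega) (by omega)⟩
  | succ t ih =>
    obtain ⟨w', h1, h2⟩ := ih (by omega)
    -- The block moving up keeps a final state visited, so a factor can start at every step: `0`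
    -- then creates state `1`, while `1` jumps to `n + 2` and does not.
    have hmem : w' ∈ shiftStar n := by
      rw [mem_shiftStar_iff]
      right
      by_cases h : t = 0
      · exact Or.inl (h2 _ (by omega) (by omega) (by omega))
      · exact Or.inr (h2 _ (by omega) (by omega) (by omega))
    refine ⟨w' ++ [if g t then 0 else 1], ?_, ?_⟩
    · intro i hi hit
      obtain rfl | ⟨i, rfl, hi'⟩ : i = 1 ∨ ∃ i', i = i' + 1 ∧ 1 ≤ i' :=
        (Nat.eq_or_lt_of_le hi).imp Eq.symm fun h => ⟨i - 1, by omega, by omega⟩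
      · rw [visits_concat_one_iff hn]
        by_cases hg : g t <;> simp [hg, hmem]
      · rw [visits_concat_succ_iff hi' (by omega), h1 i hi' (by omega),
          Nat.add_sub_add_right]
        have : (if g t then (0 : Fin 3) else 1) ≠ 2 := by split_ifs <;> decide
        tauto
    · intro i h3 h4 h5
      have hold : Visits n w' (i - 1) := h2 _ (by omega) (by omega) (by omega)
      by_cases hi : i = n + 2
      · subst hi
        rw [visits_concat_last_iff]
        exact Or.inl hold
      · obtain ⟨i, rfl⟩ : ∃ i', i = i' + 1 := ⟨i - 1, by omega⟩
        rw [visits_concat_succ_iff (by omega) (by omega)]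
        refine ⟨?_, hold⟩
        rintro ⟨h, -⟩
        split_ifs at h <;> simp at h

theorem exists_visits_full (hn : 1 ≤ n) (k : ℕ) (hk : k ≤ n) :
    ∃ w, ∀ i, 1 ≤ i → i ≤ k + 1 → Visits n w i := by
  induction k with
  | zero =>
    refine ⟨[] ++ [0], fun i h1 h2 => ?_⟩
    obtain rfl : i = 1 := by omega
    rw [visits_concat_one_iff hn]
    exact ⟨by decide, nil_mem_shiftStar⟩
  | succ k ih =>
    obtain ⟨w, hw⟩ := ih (by omega)
    -- The block `1, …, k + 1` is moved up to end at `n + 1`. While it leaves, `k + 1` new states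
    -- enter; its top is then still at `n + 2`, so one more `0` yields `k + 2` states.
    obtain ⟨w', h1, h2⟩ := exists_visits_prefix hn (w ++ List.replicate (n - k) 0)
      (k := k + 1) (by omega) (fun i hi hi' => by
        obtain ⟨i, rfl⟩ : ∃ i', i = i' + (n - k) := ⟨i - (n - k), by omega⟩
        rw [visits_append_replicate_iff (by omega) _ _ (by omega)]
        exact hw i (by omega) (by omega)) (fun _ => True) (k + 1) le_rfl
    refine ⟨w' ++ [0], fun i hi hik => ?_⟩
    obtain rfl | ⟨i, rfl, hi'⟩ : i = 1 ∨ ∃ i', i = i' + 1 ∧ 1 ≤ i' :=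
      (Nat.eq_or_lt_of_le hi).imp Eq.symm fun h => ⟨i - 1, by omega, by omega⟩
    · rw [visits_concat_one_iff hn]
      refine ⟨by decide, ?_⟩
      rw [mem_shiftStar_iff]
      exact Or.inr (Or.inr (h2 _ (by omega) (by omega) (by omega)))
    · rw [visits_concat_succ_iff hi' (by omega)]
      exact ⟨by simp, (h1 i hi' (by omega)).2 trivial⟩

theorem exists_visits_of_last (hn : 1 ≤ n) (T : ℕ → Prop) :
    ∃ w, (∀ i, 1 ≤ i → i ≤ n + 1 → (Visits n w i ↔ T i)) ∧ Visits n w (n + 2) := by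
  obtain ⟨w, hw⟩ := exists_visits_full hn n le_rfl
  obtain ⟨w', h1, h2⟩ := exists_visits_prefix hn w le_rfl
    (fun i hi hi' => hw i (by omega) (by omega)) (fun s => T (n + 1 - s)) (n + 1) le_rfl
  refine ⟨w', fun i hi hi' => ?_, h2 _ (by omega) (by omega) le_rfl⟩
  rw [h1 i hi hi', show n + 1 - (n + 1 - i) = i by omega]

theorem exists_visits_of_shift (hn : 1 ≤ n) {T : ℕ → Prop} {w : List (Fin 3)}
    (hw : ∀ i, 1 ≤ i → i ≤ n → (Visits n w i ↔ i < n ∧ T (i + 1)))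
    (hlast : ¬ Visits n w (n + 1)) (h0 : w ∈ shiftStar n ↔ T 1) :
    ∃ w, (∀ i, 1 ≤ i → i ≤ n → (Visits n w i ↔ T i)) ∧ w ∉ shiftStar n := by
  refine ⟨w ++ [0], fun i hi hin => ?_, ?_⟩
  · obtain rfl | ⟨i, rfl, hi'⟩ : i = 1 ∨ ∃ i', i = i' + 1 ∧ 1 ≤ i' :=
      (Nat.eq_or_lt_of_le hi).imp Eq.symm fun h => ⟨i - 1, by omega, by omega⟩
    · rw [visits_concat_one_iff hn, h0]
      simp
    · rw [visits_concat_succ_iff hi' (by omega), hw i hi' (by omega)]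
      simp
      omega
  · rw [mem_shiftStar_iff, visits_concat_succ_iff hn le_rfl, visits_concat_last_iff,
      hw n hn le_rfl]
    simp [hlast]

/-- Outside the star, a set is the shift of a smaller one by the letter `0`. The least element `d +
1` drops at each step back, until it is `1` and the predecessor has to lie in the star. -/
theorem exists_visits_of_not_mem (hn : 1 ≤ n) (d : ℕ) (hd : d < n) (T : ℕ → Prop)
    (hT : T (d + 1)) (hTd : ∀ i, 1 ≤ i → i ≤ d → ¬ T i) :
    ∃ w, (∀ i, 1 ≤ i → i ≤ n → (Visits n w i ↔ T i)) ∧ w ∉ shiftStar n := by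
  induction d generalizing T with
  | zero =>
    obtain ⟨w, hw, hl⟩ := exists_visits_of_last hn (fun i => i < n ∧ T (i + 1))
    refine exists_visits_of_shift hn (fun i hi hin => hw i hi (by omega)) ?_ ?_
    · rw [hw _ (by omega) le_rfl]
      omega
    · rw [mem_shiftStar_iff]
      simp only [hl, or_true, true_iff]
      exact hT
  | succ d ih =>
    obtain ⟨w, hw, hmem⟩ := ih (by omega) (fun i => i < n ∧ T (i + 1)) ⟨hd, hT⟩
      (fun i hi hid h => hTd (i + 1) (by omega) (by omega) h.2)
    refine exists_visits_of_shift hn hw (fun h => hmem ?_) ?_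
    · rw [mem_shiftStar_iff]
      exact Or.inr (Or.inl h)
    · exact iff_of_false hmem (hTd 1 le_rfl (by omega))

/-! ### Classes of live words -/

/-- The classes of live words: the visited states among `1, …, n`, together with `1` if
`n + 1` is visited, `2` if the word is in the star and `n + 1` is not visited, and `0`
otherwise. -/
abbrev LiveClass (n : ℕ) : Type :=
  {c : Finset (Fin n) × Fin 3 // c ≠ (∅, 0)}

/-- The word `w` belongs to the class `c`. -/
structure Represents (w : List (Fin 3)) (c : Finset (Fin n) × Fin 3) : Prop where
  visits_iff : ∀ i : Fin n, Visits n w (i.val + 1) ↔ i ∈ c.1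
  visits_succ_iff : Visits n w (n + 1) ↔ c.2 = 1
  mem_iff : w ∈ shiftStar n ↔ c.2 ≠ 0

theorem exists_represents (hn : 1 ≤ n) (c : LiveClass n) : ∃ w, Represents w c.1 := by
  classical
  obtain ⟨⟨B, x⟩, hc⟩ := c
  by_cases hx : x = 0
  · subst hx
    have hB : B.Nonempty := by
      rw [Finset.nonempty_iff_ne_empty]
      rintro rfl
      exact hc rfl
    let T : ℕ → Prop := fun i => ∃ j ∈ B, j.val + 1 = i
    have hT : ∀ i : Fin n, T (i.val + 1) ↔ i ∈ B := by
      refine fun i => ⟨?_, fun h => ⟨i, h, rfl⟩⟩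
      rintro ⟨j, hj, hji⟩
      obtain rfl : j = i := Fin.ext (by omega)
      exact hj
    obtain ⟨w, hw, hmem⟩ := exists_visits_of_not_mem hn (B.min' hB).val (Fin.isLt _) T
      ⟨_, B.min'_mem hB, rfl⟩ (by
        rintro i hi hid ⟨j, hj, rfl⟩
        have : (B.min' hB).val ≤ j.val := B.min'_le j hj
        omega)
    refine ⟨w, fun i => ?_, ?_, ?_⟩
    · rw [hw _ (by omega) (by omega), hT]
    · refine iff_of_false (fun h => hmem ?_) (by simp)
      rw [mem_shiftStar_iff]
      exact Or.inr (Or.inl h)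
    · exact iff_of_false hmem (by simp)
  · obtain ⟨w, hw, hl⟩ := exists_visits_of_last hn
      (fun i => (i = n + 1 ∧ x = 1) ∨ ∃ j ∈ B, j.val + 1 = i)
    refine ⟨w, fun i => ?_, ?_, ?_⟩
    · rw [hw _ (by omega) (by omega)]
      constructor
      · rintro (h | ⟨j, hj, hji⟩)
        · omega
        · obtain rfl : j = i := Fin.ext (by omega)
          exact hj
      · exact fun h => Or.inr ⟨i, h, rfl⟩
    · rw [hw _ (by omega) le_rfl]
      constructor
      · rintro (h | ⟨j, hj, hji⟩)
        · exact h.2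
        · omega
      · exact fun h => Or.inl ⟨rfl, h⟩
    · rw [mem_shiftStar_iff]
      simp [hl, hx]

theorem live_of_visits {w : List (Fin 3)} {i : ℕ} (hi : 1 ≤ i) (h : Visits n w i) :
    Live (shiftStar n) w := by
  by_cases hin : i ≤ n + 1
  · refine ⟨List.replicate (n + 1 - i) 0, ?_⟩
    have := (visits_append_replicate_iff hi w (n + 1 - i) (by omega)).2 h
    rw [show i + (n + 1 - i) = n + 1 by omega] at this
    rw [mem_shiftStar_iff]
    exact Or.inr (Or.inl this)
  · have := visits_le h
    obtain rfl : i = n + 2 := by omega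
    refine ⟨[], ?_⟩
    rw [List.append_nil, mem_shiftStar_iff]
    exact Or.inr (Or.inr h)

/-- The zeros carry `i` to `n + 1`. A final `2` then isolates that state: it is undefined at `n` and
leads from `0` only to `1`, so the word is in the star iff `n + 1` moves to `n + 2`. -/
theorem visits_iff_of_residual_eq {w w' : List (Fin 3)}
    (h : ∀ v, w ++ v ∈ shiftStar n ↔ w' ++ v ∈ shiftStar n) {i : ℕ} (hi : 1 ≤ i)
    (hin : i ≤ n + 1) (hn : 1 ≤ n) : Visits n w i ↔ Visits n w' i := by
  have key : ∀ w, w ++ (List.replicate (n + 1 - i) 0 ++ [2]) ∈ shiftStar n ↔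
      Visits n w i := by
    intro w
    rw [← visits_append_replicate_iff hi w (n + 1 - i) (by omega),
      show i + (n + 1 - i) = n + 1 by omega, ← List.append_assoc, mem_shiftStar_iff,
      visits_concat_succ_iff hn le_rfl, visits_concat_last_iff]
    simp
  rw [← key, h, key]

theorem Represents.eq_of_residual_eq (hn : 1 ≤ n) {w w' : List (Fin 3)}
    {c c' : Finset (Fin n) × Fin 3} (hw : Represents w c) (hw' : Represents w' c')
    (h : ∀ v, w ++ v ∈ shiftStar n ↔ w' ++ v ∈ shiftStar n) : c = c' := by
  refine Prod.ext (Finset.ext fun i => ?_) ?_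
  · rw [← hw.visits_iff, ← hw'.visits_iff,
      visits_iff_of_residual_eq h (by omega) (by omega) hn]
  · have h1 : c.2 = 1 ↔ c'.2 = 1 := by
      rw [← hw.visits_succ_iff, ← hw'.visits_succ_iff,
        visits_iff_of_residual_eq h (by omega) le_rfl hn]
    have h0 : c.2 ≠ 0 ↔ c'.2 ≠ 0 := by
      rw [← hw.mem_iff, ← hw'.mem_iff]
      simpa using h []
    omega

theorem Represents.live {w : List (Fin 3)} {c : LiveClass n} (hw : Represents w c.1) :
    Live (shiftStar n) w := by
  by_cases h : c.1.2 = 0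
  · have hB : c.1.1.Nonempty := by
      rw [Finset.nonempty_iff_ne_empty]
      exact fun h' => c.2 (Prod.ext h' h)
    obtain ⟨i, hi⟩ := hB
    exact live_of_visits (by omega) ((hw.visits_iff i).2 hi)
  · exact ⟨[], by simpa using hw.mem_iff.2 h⟩

theorem Represents.live_concat (hn : 1 ≤ n) {w : List (Fin 3)} {c : LiveClass n}
    (hw : Represents w c.1) (x : Fin 3)
    (hx : ¬ (c.1 = ({⟨n - 1, by omega⟩}, 0) ∧ x = 2)) : Live (shiftStar n) (w ++ [x]) := by
  by_cases h : c.1.2 = 0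
  · have hB : c.1.1.Nonempty := by
      rw [Finset.nonempty_iff_ne_empty]
      exact fun h' => c.2 (Prod.ext h' h)
    -- Some visited state survives `x`, unless `x = 2` and `n` is the only one.
    obtain ⟨i, hi, hix⟩ : ∃ i ∈ c.1.1, ¬ (x = 2 ∧ i.val + 1 = n) := by
      by_contra! hcon
      obtain ⟨j, hj⟩ := hB
      refine hx ⟨Prod.ext (Finset.eq_singleton_iff_unique_mem.2 ⟨?_, fun i hi => ?_⟩) h,
        (hcon j hj).1⟩
      · have := (hcon j hj).2
        convert hj using 1
        exact Fin.ext (by simp only; omega)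
      · have := (hcon i hi).2
        exact Fin.ext (by simp only; omega)
    refine live_of_visits (i := i.val + 1 + 1) (by omega) ?_
    rw [visits_concat_succ_iff (by omega) (by omega)]
    exact ⟨hix, (hw.visits_iff i).2 hi⟩
  · have hmem := hw.mem_iff.2 h
    by_cases hx1 : x = 1
    · refine live_of_visits (i := n + 2) (by omega) ?_
      rw [visits_concat_last_iff]
      exact Or.inr ⟨hx1, hmem⟩
    · refine live_of_visits le_rfl ?_
      rw [visits_concat_one_iff hn]
      exact ⟨hx1, hmem⟩

theorem card_liveClass (n : ℕ) : Nat.card (LiveClass n) = 2 ^ n * 3 - 1 := by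
  classical
  rw [Nat.card_eq_fintype_card, Fintype.card_subtype_compl, Fintype.card_subtype_eq]
  simp

end PartialDFA

/-! ### The numerical bounds -/

open PartialDFA in
theorem mainTheorem10 (m : ℕ) (hm : 4 ≤ m) :
    ∃ A : PartialDFA (Fin 3) (Fin m),
      (A.accepts : Set (List (Fin 3))).Finite ∧
      ∀ (σ : Type) [Finite σ] (B : PartialDFA (Fin 3) σ), B.accepts = KStar.kstar A.accepts →
        (2 : ℤ) ^ (m - 2) + 2 ^ (m - 3) - 1 ≤ (Nat.card σ : ℤ) ∧
        (Odd m → (9 : ℤ) * 2 ^ (m - 3) - 2 ^ (m / 2) - 2 ≤ (B.numTransitions : ℤ)) ∧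
        (Even m → (9 : ℤ) * 2 ^ (m - 3) - 2 ^ ((m - 2) / 2) - 2 ≤ (B.numTransitions : ℤ)) := by
  obtain ⟨n, rfl⟩ : ∃ n, m = n + 3 := ⟨m - 3, by omega⟩
  have hn : 1 ≤ n := by omega
  refine ⟨shiftDFA n, finite_accepts_shiftDFA n, fun σ _ B hB => ?_⟩
  change B.accepts = shiftStar n at hB
  choose W hW using fun c : LiveClass n => exists_represents hn c
  have hlive : ∀ c, Live B.accepts (W c) := fun c => hB ▸ (hW c).live
  have hinj : ∀ c c', (∀ v, W c ++ v ∈ B.accepts ↔ W c' ++ v ∈ B.accepts) → c = c' := by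
    rw [hB]
    exact fun c c' h => Subtype.ext ((hW c).eq_of_residual_eq hn (hW c') h)
  have hstates := card_le_card_states hlive hinj
  let c₀ : LiveClass n := ⟨({⟨n - 1, by omega⟩}, 0), by simp⟩
  have htrans := card_le_numTransitions hlive hinj {(c₀, 2)}ᶜ (by
    rintro ⟨c, x⟩ hp
    rw [hB]
    refine (hW c).live_concat hn x fun h => hp ?_
    exact Prod.ext (Subtype.ext h.1) h.2)
  rw [Set.ncard_compl, Set.ncard_singleton, Nat.card_prod, card_liveClass, Nat.card_fin]
    at htrans
  rw [card_liveClass] at hstates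
  have hpos : 1 ≤ 2 ^ n := Nat.one_le_two_pow
  have h1 : (2 : ℤ) ^ n * 3 - 1 ≤ Nat.card σ := by
    have : 2 ^ n * 3 ≤ Nat.card σ + 1 := by omega
    have : ((2 ^ n * 3 : ℕ) : ℤ) ≤ ((Nat.card σ + 1 : ℕ) : ℤ) := by exact_mod_cast this
    push_cast at this
    linarith
  have h2 : (9 : ℤ) * 2 ^ n - 4 ≤ B.numTransitions := by
    have : 9 * 2 ^ n ≤ B.numTransitions + 4 := by omega
    have : ((9 * 2 ^ n : ℕ) : ℤ) ≤ ((B.numTransitions + 4 : ℕ) : ℤ) := by exact_mod_cast this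
    push_cast at this
    linarith
  -- The subtracted power of two is at least `2`, which absorbs the gap between `- 4` and `- 2`.
  have htwo : ∀ k : ℕ, 1 ≤ k → (2 : ℤ) ≤ 2 ^ k := fun k hk => by
    simpa using pow_le_pow_right₀ (by norm_num : (1 : ℤ) ≤ 2) hk
  rw [show n + 3 - 2 = n + 1 by omega, show n + 3 - 3 = n by omega]
  refine ⟨?_, fun _ => ?_, fun _ => ?_⟩
  · rw [pow_succ]
    linarith
  · have := htwo ((n + 3) / 2) (by omega)
    linarith
  · have := htwo ((n + 1) / 2) (by omega)
    linarith
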